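/- Let $G=(V(G),E(G))$ be a finite, simple, connected graph, let $k$ be a field, and let $S=k[s_e,t_e : e\in E(G)]$ with the standard grading. For a partition $A|B$ of $V(G)$ into two disjoint (possibly empty) sets with $A\cup B=V(G)$, let $\mathrm{Cut}(A|B)$ be the set of edges with one end in $A$ and the other end in $B$, and put $$u_{A|B}=\prod_{e\in \mathrm{Cut}(A|B)}s_e\prod_{e\in E(G)\setminus \mathrm{Cut}(A|B)}t_e .$$ Let $I(G)\subseteq S$ be the monomial cut ideal of $G$, that is, the ideal generated by the monomials $u_{A|B}$ for all such partitions $A|B$. Then the following statements are equivalent: (a) $I(G)$ is unmixed, that is, all associated primes of $S/I(G)$ have the same height; (b) $I(G)$ has a linear resolution, that is, for some $d$ the minimal graded free resolution of $I(G)$ has the form $\cdots\to S(-d-2)^{\beta_2}\to S(-d-1)^{\beta_1}\to S(-d)^{\beta_0}\to I(G)\to 0$; (c) $I(G)$ has only linear relations, that is, $I(G)$ is minimally generated by forms of a single degree, and the module of relations (first syzygies) of these generators is generated by relations all of whose coefficients are linear forms; (d) $G$ is a tree. -/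

import Mathlib

noncomputable section

namespace MonomialCut

section CutIdeal

variable {V : Type*} (G : SimpleGraph V) (k : Type*) [Field k]

/-- The polynomial ring `k[s_e, t_e : e ∈ E(G)]`; `Sum.inl e` is the index of `s_e` and
`Sum.inr e` is the index of `t_e`. -/
abbrev CutRing : Type _ := MvPolynomial (G.edgeSet ⊕ G.edgeSet) k

variable {G} in
/-- The variable `s_e`. -/
def sVar (e : G.edgeSet) : CutRing G k := MvPolynomial.X (Sum.inl e)

variable {G} in
/-- The variable `t_e`. -/
def tVar (e : G.edgeSet) : CutRing G k := MvPolynomial.X (Sum.inr e)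

/-- `Cut(A|B)`: the edges with one end in `A` and the other end in `B`. -/
def cut (A B : Set V) : Set G.edgeSet :=
  {e | ∃ i ∈ A, ∃ j ∈ B, (e : Sym2 V) = s(i, j)}

open Classical in
/-- The monomial `u_{A|B}`: the product of the `s_e` over the edges `e` in the cut and of the
`t_e` over the remaining edges. -/
def cutMonomial [Fintype G.edgeSet] (A B : Set V) : CutRing G k :=
  (∏ e : G.edgeSet with e ∈ cut G A B, sVar k e) * ∏ e : G.edgeSet with e ∉ cut G A B, tVar k e

/-- The monomial cut ideal `I(G)`, generated by the monomials `u_{A|B}` for all partitions of the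
vertex set into two (possibly empty) parts. Since `u_{A|B} = u_{B|A}`, it does not matter whether
the partitions are ordered. -/
def cutIdeal [Fintype G.edgeSet] : Ideal (CutRing G k) :=
  Ideal.span {u | ∃ A B : Set V, A ∪ B = Set.univ ∧ A ∩ B = ∅ ∧ u = cutMonomial G k A B}

end CutIdeal

/-- An ideal `I` of `R` is unmixed if all the associated primes of `R / I` have the same height. -/
def IsUnmixed {R : Type*} [CommRing R] (I : Ideal R) : Prop :=
  ∀ p ∈ associatedPrimes R (R ⧸ I), ∀ q ∈ associatedPrimes R (R ⧸ I), p.height = q.height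

section Resolution

variable {σ k : Type*} [Field k]

/-- A graded free resolution `⋯ → F₂ → F₁ → F₀ → I → 0` of an ideal `I` of the standard graded
polynomial ring `S`. The module `F_i` is free of finite rank `rank i`, its `a`-th basis vector has
degree `deg i a` (so `F_i = ⨁ₐ S(-deg i a)`), and all maps are homogeneous of degree `0`. -/
structure GradedFreeResolution (I : Ideal (MvPolynomial σ k)) where
  rank : ℕ → ℕ
  deg : (i : ℕ) → Fin (rank i) → ℕ
  /-- The images in `I` of the basis vectors of `F₀`. -/
  gen : Fin (rank 0) → MvPolynomial σ k
  /-- The matrix of the differential `F_{i+1} → F_i`. -/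
  diff : (i : ℕ) → Matrix (Fin (rank i)) (Fin (rank (i + 1))) (MvPolynomial σ k)
  gen_homogeneous : ∀ a, (gen a).IsHomogeneous (deg 0 a)
  diff_homogeneous : ∀ i a b, diff i a b = 0 ∨
    ∃ e, deg (i + 1) b = deg i a + e ∧ (diff i a b).IsHomogeneous e
  span_gen : Ideal.span (Set.range gen) = I
  exact_zero : LinearMap.ker (Fintype.linearCombination (MvPolynomial σ k) gen) =
    LinearMap.range (diff 0).mulVecLin
  exact_succ : ∀ i, LinearMap.ker (diff i).mulVecLin = LinearMap.range (diff (i + 1)).mulVecLin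

/-- A graded free resolution is minimal if the entries of all its differentials lie in the
homogeneous maximal ideal. -/
def GradedFreeResolution.IsMinimal {I : Ideal (MvPolynomial σ k)}
    (F : GradedFreeResolution I) : Prop :=
  ∀ i a b, MvPolynomial.constantCoeff (F.diff i a b) = 0

/-- `I` has a linear resolution: for some `d`, its minimal graded free resolution (which is unique
up to isomorphism) has the form `⋯ → S(-d-2)^{β₂} → S(-d-1)^{β₁} → S(-d)^{β₀} → I → 0`. -/
def HasLinearResolution (I : Ideal (MvPolynomial σ k)) : Prop :=
  ∃ F : GradedFreeResolution I, F.IsMinimal ∧ ∃ d : ℕ, ∀ i a, F.deg i a = d + i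

/-- The module of relations (first syzygies) of a finite family of polynomials. -/
def relations {n : ℕ} (f : Fin n → MvPolynomial σ k) :
    Submodule (MvPolynomial σ k) (Fin n → MvPolynomial σ k) :=
  LinearMap.ker (Fintype.linearCombination (MvPolynomial σ k) f)

/-- `I` has only linear relations: `I` is minimally generated by forms of one degree `d`, and the
module of relations of these generators is generated by linear relations, that is, by relations all
of whose coefficients are linear forms. (The choice of the minimal system of generators does not
matter, as any two of them differ by an invertible matrix over `k`.) -/
def HasOnlyLinearRelations (I : Ideal (MvPolynomial σ k)) : Prop :=
  ∃ (d n : ℕ) (f : Fin n → MvPolynomial σ k),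
    (∀ a, (f a).IsHomogeneous d) ∧
    Ideal.span (Set.range f) = I ∧
    (∀ a, f a ∉ Ideal.span (f '' {b | b ≠ a})) ∧
    Submodule.span (MvPolynomial σ k) {c | c ∈ relations f ∧ ∀ a, (c a).IsHomogeneous 1} =
      relations f

end Resolution

end MonomialCut

end

/-! Everything hinges on bridges. If every edge is a bridge, then every set of edges is a cut: each
singleton is a cut, and cuts are closed under symmetric difference. Hence I(G) is the intersection,
and even the product, of the primes (s_e, t_e). Its associated primes are among these, all of height
2, and iterated mapping cones (in effect a tensor product of Koszul-type resolutions) give a linear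
resolution.

Conversely, let e₀ be an edge that is not a bridge. Two cuts that differ at e₀ must then differ at
another edge too (`isBridge_of_cut_agree`). Comparison with the empty cut shows that I(G) lies in
the prime generated by t_{e₀} and the s_e with e ≠ e₀. A minimal prime below it has height at least
3, while one below (s_{e₀}, t_{e₀}) has height at most 2, so I(G) is not unmixed. Moreover, no
linear relation links cut monomials with e₀ in the cut to those without, whereas the trivial
relation between one of each kind does; so the relations are not generated by linear ones.

That a linear resolution yields linear relations is read off its first differential. Connectedness
only serves to turn a forest into a tree. -/

namespace MonomialCut

open MvPolynomial

/-! ### Primes generated by variables and their heights -/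

section VariableIdeals

variable {σ k : Type*} [Field k]

/-- An ideal generated by variables is prime. -/
theorem isPrime_span_X_image (s : Set σ) :
    (Ideal.span (X '' s : Set (MvPolynomial σ k))).IsPrime := by
  classical
  set J := Ideal.span (X '' s : Set (MvPolynomial σ k))
  -- The substitution killing the variables in `s`; its kernel is `J`.
  let φ : MvPolynomial σ k →ₐ[k] MvPolynomial σ k := aeval fun i => if i ∈ s then 0 else X i
  have hφ : ∀ f, f - φ f ∈ J := by
    intro f
    induction f using MvPolynomial.induction_on with
    | C a => simp [φ]
    | add p q hp hq =>
      have := J.add_mem hp hq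
      rwa [map_add, add_sub_add_comm]
    | mul_X p i hp =>
      rw [map_mul]
      by_cases hi : i ∈ s
      · have h0 : φ (X i) = 0 := by simp [φ, hi]
        rw [h0, mul_zero, sub_zero]
        exact J.mul_mem_left _ (Ideal.subset_span ⟨i, hi, rfl⟩)
      · have h0 : φ (X i) = X i := by simp [φ, hi]
        rw [h0, ← sub_mul]
        exact J.mul_mem_right _ hp
  have hker : J = RingHom.ker φ := by
    apply le_antisymm
    · refine Ideal.span_le.2 ?_
      rintro _ ⟨i, hi, rfl⟩
      simp [φ, hi, RingHom.mem_ker]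
    · intro f hf
      have := hφ f
      rwa [RingHom.mem_ker.1 hf, sub_zero] at this
  rw [hker]
  exact RingHom.ker_isPrime _

theorem X_mem_span_X_image {s : Set σ} {i : σ} :
    (X i : MvPolynomial σ k) ∈ Ideal.span (X '' s : Set (MvPolynomial σ k)) ↔ i ∈ s := by
  rw [mem_ideal_span_X_image]
  simp only [support_X, Finset.mem_singleton, forall_eq]
  constructor
  · rintro ⟨j, hj, h⟩
    by_cases hij : i = j
    · exact hij ▸ hj
    · simp [hij] at h
  · intro h
    exact ⟨i, h, by simp⟩

/-- A prime ideal containing `n` distinct variables has height at least `n`. -/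
theorem card_le_height_of_X_mem (p : Ideal (MvPolynomial σ k)) [p.IsPrime] (s : Finset σ)
    (hs : ∀ i ∈ s, (X i : MvPolynomial σ k) ∈ p) : (s.card : ℕ∞) ≤ p.height := by
  classical
  -- Adjoining the variables one at a time gives a strict chain of primes.
  have key : (s.card : ℕ∞) ≤
      (Ideal.span (X '' (s : Set σ) : Set (MvPolynomial σ k))).height := by
    clear hs
    induction s using Finset.induction_on with
    | empty => simp
    | insert a s ha ih =>
      have := isPrime_span_X_image (k := k) (s : Set σ)
      have := isPrime_span_X_image (k := k) ((insert a s : Finset σ) : Set σ)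
      have hlt : Ideal.span (X '' (s : Set σ) : Set (MvPolynomial σ k)) <
          Ideal.span (X '' ((insert a s : Finset σ) : Set σ)) := by
        refine lt_of_le_of_ne (Ideal.span_mono (Set.image_mono (by simp))) fun h => ha ?_
        have h1 : (X a : MvPolynomial σ k) ∈
            Ideal.span (X '' ((insert a s : Finset σ) : Set σ)) :=
          X_mem_span_X_image.2 (by simp)
        rw [← h, X_mem_span_X_image] at h1
        simpa using h1
      have h := Ideal.height_add_one_le_of_lt_of_isPrime hlt
      rw [Finset.card_insert_of_notMem ha, Nat.cast_add, Nat.cast_one]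
      exact (add_le_add_left ih 1).trans h
  refine key.trans (Ideal.height_mono (Ideal.span_le.2 ?_))
  rintro _ ⟨i, hi, rfl⟩
  exact hs i hi

theorem height_span_pair_le {R : Type*} [CommRing R] [IsNoetherianRing R] (x y : R)
    (h : Ideal.span {x, y} ≠ ⊤) : (Ideal.span {x, y}).height ≤ 2 := by
  obtain ⟨p, hp⟩ := Ideal.nonempty_minimalPrimes h
  have := hp.1.1
  refine (Ideal.height_mono hp.1.2).trans
    ((Ideal.height_le_card_of_mem_minimalPrimes_span (Set.toFinite _) hp).trans ?_)
  exact_mod_cast (Set.ncard_insert_le x {y}).trans (by simp)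

end VariableIdeals

/-! ### Cuts, bridges and forests -/

section Cuts

variable {V : Type*} {G : SimpleGraph V}

theorem mem_cut_compl {A : Set V} {e : G.edgeSet} {v w : V} (he : (e : Sym2 V) = s(v, w)) :
    e ∈ cut G A Aᶜ ↔ ¬(v ∈ A ↔ w ∈ A) := by
  simp only [cut, Set.mem_ofPred_eq, he, Set.mem_compl_iff]
  constructor
  · rintro ⟨i, hi, j, hj, h⟩
    rcases Sym2.eq_iff.1 h with ⟨rfl, rfl⟩ | ⟨rfl, rfl⟩ <;> tauto
  · intro h
    by_cases hv : v ∈ A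
    · exact ⟨v, hv, w, by tauto, rfl⟩
    · exact ⟨w, by tauto, v, hv, Sym2.eq_swap⟩

theorem notMem_cut_empty (B : Set V) (e : G.edgeSet) : e ∉ cut G ∅ B := by
  rintro ⟨i, hi, -⟩
  exact hi

/-- Any two edges of a simple graph are separated by a cut. -/
theorem exists_mem_cut_notMem_cut {e₀ e₁ : G.edgeSet} (h : e₁ ≠ e₀) :
    ∃ A : Set V, e₀ ∈ cut G A Aᶜ ∧ e₁ ∉ cut G A Aᶜ := by
  obtain ⟨e₀, h₀⟩ := e₀
  obtain ⟨e₁, h₁⟩ := e₁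
  induction e₀ with
  | h v w =>
    induction e₁ with
    | h x y =>
      have hvw : v ≠ w := G.ne_of_adj h₀
      have hxy : x ≠ y := G.ne_of_adj h₁
      have hne : ¬((x = v ∧ y = w) ∨ (x = w ∧ y = v)) := by
        rw [← Sym2.eq_iff]
        exact fun h' => h (Subtype.ext h')
      by_cases hv : x = v ∨ y = v
      · refine ⟨{w}, ?_⟩
        rw [mem_cut_compl rfl, mem_cut_compl rfl]
        simp only [Set.mem_singleton_iff]
        grind
      · refine ⟨{v}, ?_⟩
        rw [mem_cut_compl rfl, mem_cut_compl rfl]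
        simp only [Set.mem_singleton_iff]
        grind

/-- An edge is a bridge as soon as it is the only edge on which two cuts differ. -/
theorem isBridge_of_cut_agree {A A' : Set V} {e₀ : G.edgeSet} (h₁ : e₀ ∈ cut G A Aᶜ)
    (h₂ : e₀ ∉ cut G A' A'ᶜ)
    (h : ∀ e : G.edgeSet, e ≠ e₀ → (e ∈ cut G A Aᶜ ↔ e ∈ cut G A' A'ᶜ)) : G.IsBridge e₀ := by
  obtain ⟨e₀, he₀⟩ := e₀
  induction e₀ with
  | h v w =>
    rw [SimpleGraph.isBridge_iff]
    rintro ⟨p⟩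
    -- Whether `A` and `A'` agree at a vertex is constant along walks avoiding `s(v, w)`, but it
    -- changes between `v` and `w`.
    have step : ∀ {x y : V}, (G.deleteEdges {s(v, w)}).Walk x y →
        ((x ∈ A ↔ x ∈ A') ↔ (y ∈ A ↔ y ∈ A')) := by
      intro x y p
      induction p with
      | nil => rfl
      | cons hadj _ ih =>
        rw [SimpleGraph.deleteEdges_adj] at hadj
        have := h ⟨s(_, _), hadj.1⟩ (fun h' => hadj.2 (congrArg Subtype.val h'))
        rw [mem_cut_compl rfl, mem_cut_compl rfl] at this
        tauto
    have := step p
    rw [mem_cut_compl rfl] at h₁ h₂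
    tauto

/-- Take the component of one end after the bridge is deleted. -/
theorem exists_cut_eq_singleton {e : G.edgeSet} (he : G.IsBridge e) :
    ∃ A : Set V, cut G A Aᶜ = {e} := by
  obtain ⟨e, hmem⟩ := e
  induction e with
  | h v w =>
    rw [SimpleGraph.isBridge_iff] at he
    refine ⟨{x | (G.deleteEdges {s(v, w)}).Reachable v x}, ?_⟩
    ext ⟨f, hf⟩
    induction f with
    | h x y =>
      rw [mem_cut_compl rfl, Set.mem_singleton_iff, Subtype.mk.injEq]
      simp only [Set.mem_ofPred_eq]
      constructor
      · intro h
        by_contra hne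
        have hadj : (G.deleteEdges {s(v, w)}).Adj x y := by
          rw [SimpleGraph.deleteEdges_adj]
          exact ⟨hf, hne⟩
        exact h ⟨fun h' => h'.trans hadj.reachable, fun h' => h'.trans hadj.symm.reachable⟩
      · intro h
        have hvv : (G.deleteEdges {s(v, w)}).Reachable v v := .rfl
        rcases Sym2.eq_iff.1 h with ⟨rfl, rfl⟩ | ⟨rfl, rfl⟩ <;> tauto

/-- In a forest, every set of edges is a cut. -/
theorem exists_cut_eq_of_isAcyclic [Finite G.edgeSet] (hG : G.IsAcyclic) (C : Set G.edgeSet) :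
    ∃ A : Set V, cut G A Aᶜ = C := by
  induction C, Set.toFinite C using Set.Finite.induction_on with
  | empty =>
    refine ⟨∅, ?_⟩
    ext ⟨e, he⟩
    induction e with
    | h v w => rw [mem_cut_compl rfl]; simp
  | @insert a C ha _ ih =>
    obtain ⟨A, hA⟩ := ih
    obtain ⟨B, hB⟩ := exists_cut_eq_singleton
      (SimpleGraph.isAcyclic_iff_forall_isBridge.1 hG a.2)
    -- The cut of a symmetric difference is the symmetric difference of the cuts.
    refine ⟨{x | ¬(x ∈ A ↔ x ∈ B)}, ?_⟩
    ext f
    have h1 : f ∈ cut G A Aᶜ ↔ f ∈ C := by rw [hA]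
    have h2 : f ∈ cut G B Bᶜ ↔ f = a := by rw [hB]; rfl
    have h3 : f = a → f ∉ C := by rintro rfl; exact ha
    obtain ⟨f, hf⟩ := f
    induction f with
    | h x y =>
      rw [mem_cut_compl rfl] at h1 h2 ⊢
      rw [Set.mem_insert_iff]
      simp only [Set.mem_ofPred_eq]
      tauto

end Cuts

/-! ### Exponent vectors of the cut monomials -/

section CutExponents

variable {V : Type*} (G : SimpleGraph V) (k : Type*) [Field k] [Fintype G.edgeSet]

open Classical in
/-- The exponent vector of `∏_{e ∈ C} s_e ∏_{e ∉ C} t_e`. -/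
noncomputable def cutExponent (C : Set G.edgeSet) : G.edgeSet ⊕ G.edgeSet →₀ ℕ :=
  Finsupp.equivFunOnFinite.symm
    (Sum.elim (fun e => if e ∈ C then 1 else 0) fun e => if e ∈ C then 0 else 1)

variable {G}

open Classical in
@[simp] theorem cutExponent_inl (C : Set G.edgeSet) (e : G.edgeSet) :
    cutExponent G C (Sum.inl e) = if e ∈ C then 1 else 0 := by simp [cutExponent]

open Classical in
@[simp] theorem cutExponent_inr (C : Set G.edgeSet) (e : G.edgeSet) :
    cutExponent G C (Sum.inr e) = if e ∈ C then 0 else 1 := by simp [cutExponent]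

theorem cutMonomial_eq (A B : Set V) :
    cutMonomial G k A B = monomial (cutExponent G (cut G A B)) 1 := by
  classical
  have : (monomial (cutExponent G (cut G A B)) 1 : CutRing G k) =
      ∏ i, X i ^ cutExponent G (cut G A B) i := by
    rw [monomial_eq, C_1, one_mul, Finsupp.prod_fintype _ _ (by simp)]
  rw [this, Fintype.prod_sum_type, cutMonomial, Finset.prod_filter, Finset.prod_filter]
  congr 1 <;> refine Finset.prod_congr rfl fun e _ => ?_ <;> by_cases h : e ∈ cut G A B <;>
    simp [h, sVar, tVar]

theorem cutIdeal_eq : cutIdeal G k = Ideal.span ((fun m => monomial m (1 : k)) ''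
    Set.range fun A : Set V => cutExponent G (cut G A Aᶜ)) := by
  rw [cutIdeal]
  congr 1
  ext u
  simp only [Set.mem_ofPred_eq, Set.mem_image, Set.mem_range, exists_exists_eq_and]
  constructor
  · rintro ⟨A, B, h1, h2, rfl⟩
    have : B = Aᶜ := by
      ext x
      have h1 : x ∈ A ∪ B := h1 ▸ Set.mem_univ x
      have h2 : x ∉ A ∩ B := h2 ▸ Set.notMem_empty x
      simp only [Set.mem_union, Set.mem_inter_iff, Set.mem_compl_iff] at *
      tauto
    exact ⟨A, by rw [cutMonomial_eq, this]⟩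
  · rintro ⟨A, rfl⟩
    exact ⟨A, Aᶜ, by simp, by simp, by rw [cutMonomial_eq]⟩

variable {k} in
theorem mem_cutIdeal {f : CutRing G k} : f ∈ cutIdeal G k ↔
    ∀ m ∈ f.support, ∃ A : Set V, cutExponent G (cut G A Aᶜ) ≤ m := by
  rw [cutIdeal_eq, mem_ideal_span_monomial_image]
  simp

theorem monomial_cutExponent_mem (A : Set V) :
    (monomial (cutExponent G (cut G A Aᶜ)) 1 : CutRing G k) ∈ cutIdeal G k := by
  rw [cutIdeal_eq]
  exact Ideal.subset_span ⟨_, ⟨A, rfl⟩, rfl⟩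

theorem degree_cutExponent (C : Set G.edgeSet) :
    (cutExponent G C).degree = Fintype.card G.edgeSet := by
  classical
  rw [Finsupp.degree_eq_sum, Fintype.sum_sum_type, ← Finset.sum_add_distrib,
    Fintype.card_eq_sum_ones]
  refine Finset.sum_congr rfl fun e _ => ?_
  by_cases h : e ∈ C <;> simp [h]

/-- For a prime ideal containing the monomial of `C`, some variable of it lies in the ideal. -/
theorem exists_X_mem_of_monomial_cutExponent_mem {p : Ideal (CutRing G k)} [p.IsPrime]
    {C : Set G.edgeSet} (h : (monomial (cutExponent G C) 1 : CutRing G k) ∈ p) :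
    ∃ e, (e ∈ C ∧ sVar k e ∈ p) ∨ (e ∉ C ∧ tVar k e ∈ p) := by
  classical
  rw [monomial_eq, C_1, one_mul, Finsupp.prod_fintype _ _ (by simp),
    Ideal.IsPrime.prod_mem_iff] at h
  obtain ⟨i, -, hi⟩ := h
  rcases i with e | e <;> refine ⟨e, ?_⟩ <;> by_cases he : e ∈ C
  · exact Or.inl ⟨he, by simpa [he, sVar, tVar] using hi⟩
  · exact absurd (by simpa [he] using hi) (Ideal.IsPrime.one_notMem ‹_›)
  · exact absurd (by simpa [he] using hi) (Ideal.IsPrime.one_notMem ‹_›)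
  · exact Or.inr ⟨he, by simpa [he, sVar, tVar] using hi⟩

end CutExponents

/-! ### Unmixedness and forests -/

section Unmixed

theorem minimalPrimes_subset_associatedPrimes {R : Type*} [CommRing R] [IsNoetherianRing R]
    (I : Ideal R) : I.minimalPrimes ⊆ associatedPrimes R (R ⧸ I) := by
  have := Module.associatedPrimes.minimalPrimes_annihilator_subset_associatedPrimes R (R ⧸ I)
  rwa [Ideal.annihilator_quotient] at this

/-- The associated primes of a finite intersection of primes are among these primes. -/
theorem exists_eq_of_mem_associatedPrimes_inf {R ι : Type*} [CommRing R] [IsNoetherianRing R]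
    (T : Finset ι) (P : ι → Ideal R) [∀ i, (P i).IsPrime] {p : Ideal R}
    (hp : p ∈ associatedPrimes R (R ⧸ T.inf P)) : ∃ i ∈ T, p = P i := by
  classical
  obtain ⟨hprime, x, hx⟩ := isAssociatedPrime_iff.1 hp
  obtain ⟨y, rfl⟩ := Ideal.Quotient.mk_surjective x
  have hmem : ∀ r, r ∈ p ↔ ∀ i ∈ T, r * y ∈ P i := by
    intro r
    rw [hx, Submodule.mem_colon_singleton, Submodule.mem_bot, Algebra.smul_def,
      Ideal.Quotient.algebraMap_eq, ← map_mul, Ideal.Quotient.eq_zero_iff_mem,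
      Submodule.mem_finsetInf]
  -- Only the `P i` not containing `y` constrain the annihilator of `y`; the prime `p`, containing
  -- their intersection, contains one of them.
  have hle : (T.filter fun i => y ∉ P i).inf P ≤ p := by
    intro r hr
    rw [Submodule.mem_finsetInf] at hr
    refine (hmem r).2 fun i hi => ?_
    by_cases hy : y ∈ P i
    · exact Ideal.mul_mem_left _ _ hy
    · exact Ideal.mul_mem_right _ _ (hr i (Finset.mem_filter.2 ⟨hi, hy⟩))
  obtain ⟨i, hi, hip⟩ := (Ideal.IsPrime.inf_le' hprime).1 hle
  rw [Finset.mem_filter] at hi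
  refine ⟨i, hi.1, le_antisymm (fun r hr => ?_) hip⟩
  exact (Ideal.IsPrime.mem_or_mem inferInstance ((hmem r).1 hr i hi.1)).resolve_right hi.2

variable {V : Type*} {G : SimpleGraph V} (k : Type*) [Field k]

/-- The prime ideal `(s_e, t_e)`. -/
noncomputable def edgeIdeal (e : G.edgeSet) : Ideal (CutRing G k) := Ideal.span (X '' {Sum.inl e, Sum.inr e})

instance (e : G.edgeSet) : (edgeIdeal k e).IsPrime := isPrime_span_X_image _

theorem edgeIdeal_eq_span_pair (e : G.edgeSet) :
    edgeIdeal k e = Ideal.span {sVar k e, tVar k e} := by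
  rw [edgeIdeal, Set.image_pair]; rfl

variable {k} in
theorem mem_edgeIdeal {e : G.edgeSet} {f : CutRing G k} :
    f ∈ edgeIdeal k e ↔ ∀ m ∈ f.support, m (Sum.inl e) ≠ 0 ∨ m (Sum.inr e) ≠ 0 := by
  rw [edgeIdeal, mem_ideal_span_X_image]
  simp

theorem sVar_mem_edgeIdeal (e : G.edgeSet) : sVar k e ∈ edgeIdeal k e :=
  X_mem_span_X_image.2 (by simp)

theorem tVar_mem_edgeIdeal (e : G.edgeSet) : tVar k e ∈ edgeIdeal k e :=
  X_mem_span_X_image.2 (by simp)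

variable [Fintype G.edgeSet]

theorem height_edgeIdeal (e : G.edgeSet) : (edgeIdeal k e).height = 2 := by
  classical
  apply le_antisymm
  · have hne : edgeIdeal k e ≠ ⊤ := Ideal.IsPrime.ne_top inferInstance
    rw [edgeIdeal_eq_span_pair] at hne ⊢
    exact height_span_pair_le _ _ hne
  · have := card_le_height_of_X_mem (edgeIdeal k e) {Sum.inl e, Sum.inr e} (by
      simp only [Finset.mem_insert, Finset.mem_singleton]
      rintro i (rfl | rfl)
      · exact sVar_mem_edgeIdeal k e
      · exact tVar_mem_edgeIdeal k e)
    simpa using this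

theorem cutIdeal_le_edgeIdeal (e : G.edgeSet) : cutIdeal G k ≤ edgeIdeal k e := by
  classical
  intro f hf
  refine mem_edgeIdeal.2 fun m hm => ?_
  obtain ⟨A, hA⟩ := mem_cutIdeal.1 hf m hm
  have h1 := hA (Sum.inl e)
  have h2 := hA (Sum.inr e)
  by_cases h : e ∈ cut G A Aᶜ <;> simp only [cutExponent_inl, cutExponent_inr, h, if_true,
    if_false] at h1 h2 <;> omega

/-- For a monomial in every (s_e, t_e), the edges whose s_e divides it form a cut, and the monomial
of this cut divides it. -/
theorem cutIdeal_eq_inf_edgeIdeal (hG : G.IsAcyclic) :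
    cutIdeal G k = Finset.univ.inf (edgeIdeal (G := G) k) := by
  classical
  refine le_antisymm (Finset.le_inf fun e _ => cutIdeal_le_edgeIdeal k e) fun f hf => ?_
  rw [Submodule.mem_finsetInf] at hf
  refine mem_cutIdeal.2 fun m hm => ?_
  obtain ⟨A, hA⟩ := exists_cut_eq_of_isAcyclic hG {e | m (Sum.inl e) ≠ 0}
  refine ⟨A, fun i => ?_⟩
  rw [hA]
  rcases i with e | e
  · by_cases h : m (Sum.inl e) = 0 <;> simp [h]
    omega
  · have := mem_edgeIdeal.1 (hf e (Finset.mem_univ e)) m hm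
    by_cases h : m (Sum.inl e) = 0 <;> simp [h]
    simp [h] at this
    omega

theorem isUnmixed_cutIdeal_of_isAcyclic (hG : G.IsAcyclic) : IsUnmixed (cutIdeal G k) := by
  intro p hp q hq
  rw [cutIdeal_eq_inf_edgeIdeal k hG] at hp hq
  obtain ⟨e, -, rfl⟩ := exists_eq_of_mem_associatedPrimes_inf _ _ hp
  obtain ⟨e', -, rfl⟩ := exists_eq_of_mem_associatedPrimes_inf _ _ hq
  rw [height_edgeIdeal, height_edgeIdeal]

/-- A cut through e₀ has a second edge, so the prime on the variables `Z` contains the ideal. Let p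
be a minimal prime below it; its only variables are from `Z`. The empty cut puts t_{e₀} into p, a
cut through e₀ puts in some s_{e₁}, and a cut through e₀ avoiding e₁ puts in another s_{e₂}. -/
theorem exists_minimalPrime_height_ge_three {e₀ : G.edgeSet} (he₀ : ¬G.IsBridge e₀) :
    ∃ p ∈ (cutIdeal G k).minimalPrimes, 3 ≤ p.height := by
  classical
  set Z : Set (G.edgeSet ⊕ G.edgeSet) := insert (Sum.inr e₀) {i | ∃ e ≠ e₀, i = Sum.inl e}
  have hQ := isPrime_span_X_image (k := k) Z
  have hIQ : cutIdeal G k ≤ Ideal.span (X '' Z) := by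
    intro f hf
    refine mem_ideal_span_X_image.2 fun m hm => ?_
    obtain ⟨A, hA⟩ := mem_cutIdeal.1 hf m hm
    by_cases h0 : e₀ ∈ cut G A Aᶜ
    · obtain ⟨e, hne, he⟩ : ∃ e, e ≠ e₀ ∧ e ∈ cut G A Aᶜ := by
        by_contra! hcon
        exact he₀ (isBridge_of_cut_agree h0 (notMem_cut_empty _ e₀) fun e he =>
          iff_of_false (hcon e he) (notMem_cut_empty _ e))
      have h1 := hA (Sum.inl e)
      rw [cutExponent_inl, if_pos he] at h1
      exact ⟨Sum.inl e, Or.inr ⟨e, hne, rfl⟩, by omega⟩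
    · have h1 := hA (Sum.inr e₀)
      rw [cutExponent_inr, if_neg h0] at h1
      exact ⟨Sum.inr e₀, Or.inl rfl, by omega⟩
  obtain ⟨p, hp, hpQ⟩ := Ideal.exists_minimalPrimes_le hIQ
  have hprime := hp.1.1
  have hs : ∀ e, sVar k e ∈ p → e ≠ e₀ := by
    intro e he
    rcases X_mem_span_X_image.1 (hpQ he) with h | ⟨e', hne, h⟩
    · simp at h
    · rwa [Sum.inl.inj h]
  have ht : ∀ e, tVar k e ∈ p → e = e₀ := by
    intro e he
    rcases X_mem_span_X_image.1 (hpQ he) with h | ⟨e', hne, h⟩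
    · exact Sum.inr.inj h
    · simp at h
  have hcut : ∀ A : Set V, e₀ ∈ cut G A Aᶜ → ∃ e ∈ cut G A Aᶜ, sVar k e ∈ p := by
    intro A hA
    obtain ⟨e, h | h⟩ :=
      exists_X_mem_of_monomial_cutExponent_mem k (hp.1.2 (monomial_cutExponent_mem k A))
    · exact ⟨e, h⟩
    · exact absurd (ht e h.2 ▸ hA) h.1
  have ht₀ : tVar k e₀ ∈ p := by
    obtain ⟨e, h | h⟩ :=
      exists_X_mem_of_monomial_cutExponent_mem k (hp.1.2 (monomial_cutExponent_mem k (∅ : Set V)))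
    · exact absurd h.1 (notMem_cut_empty _ e)
    · exact ht e h.2 ▸ h.2
  obtain ⟨e₁, h₁⟩ : ∃ e₁, sVar k e₁ ∈ p := by
    obtain ⟨e, he⟩ := e₀
    induction e with
    | h v w =>
      have hvw : v ≠ w := G.ne_of_adj he
      obtain ⟨e₁, -, h⟩ := hcut {v} ((mem_cut_compl rfl).2 (by simp [hvw.symm]))
      exact ⟨e₁, h⟩
  obtain ⟨A, hA, hA₁⟩ := exists_mem_cut_notMem_cut (hs e₁ h₁)
  obtain ⟨e₂, he₂, h₂⟩ := hcut A hA
  have hne : e₁ ≠ e₂ := by rintro rfl; exact hA₁ he₂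
  refine ⟨p, hp, ?_⟩
  have := card_le_height_of_X_mem p {Sum.inr e₀, Sum.inl e₁, Sum.inl e₂} (by
    simp only [Finset.mem_insert, Finset.mem_singleton]
    rintro i (rfl | rfl | rfl)
    exacts [ht₀, h₁, h₂])
  rw [Finset.card_insert_of_notMem (by simp), Finset.card_pair (by simpa using hne)] at this
  exact_mod_cast this

theorem isAcyclic_of_isUnmixed (h : IsUnmixed (cutIdeal G k)) : G.IsAcyclic := by
  rw [SimpleGraph.isAcyclic_iff_forall_isBridge]
  intro e he
  by_contra hb
  obtain ⟨p, hp, h3⟩ := exists_minimalPrime_height_ge_three k (e₀ := ⟨e, he⟩) hb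
  -- A minimal prime below (s_e, t_e) has height at most 2.
  obtain ⟨q, hq, hqe⟩ := Ideal.exists_minimalPrimes_le (cutIdeal_le_edgeIdeal k ⟨e, he⟩)
  have h2 := Ideal.height_mono hqe
  rw [height_edgeIdeal, ← h p (minimalPrimes_subset_associatedPrimes _ hp) q
    (minimalPrimes_subset_associatedPrimes _ hq)] at h2
  exact absurd (h3.trans h2) (by decide)

end Unmixed

/-! ### Linear relations respect linear adjacency of exponents -/

section LinearRelations

variable {σ k : Type*} [Field k]

/-- The part of a polynomial supported on a finite set of exponents. -/
noncomputable def supportPart (K : Finset (σ →₀ ℕ)) (f : MvPolynomial σ k) : MvPolynomial σ k :=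
  ∑ m ∈ K, monomial m (coeff m f)

open Classical in
theorem coeff_supportPart (K : Finset (σ →₀ ℕ)) (f : MvPolynomial σ k) (m : σ →₀ ℕ) :
    coeff m (supportPart K f) = if m ∈ K then coeff m f else 0 := by
  rw [supportPart, coeff_sum]
  simp_rw [coeff_monomial]
  simp

theorem coeff_mul_of_isHomogeneous {d : ℕ} {f g : MvPolynomial σ k} {m : σ →₀ ℕ}
    (hf : f.IsHomogeneous d) (hm : m.degree = d) :
    coeff m (g * f) = constantCoeff g * coeff m f := by
  classical
  rw [coeff_mul, Finset.sum_eq_single (0, m)]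
  · rfl
  · rintro ⟨i, j⟩ hij hne
    rw [Finset.HasAntidiagonal.mem_antidiagonal] at hij
    by_contra h
    have hj : j.degree = d := by
      by_contra hj
      exact h (by rw [hf.coeff_eq_zero hj, mul_zero])
    have hi : i.degree = 0 := by
      have := congrArg Finsupp.degree hij
      rw [map_add] at this
      dsimp only at this
      omega
    rw [Finsupp.degree_eq_zero_iff] at hi
    subst hi
    simp only [zero_add] at hij
    exact hne (by rw [hij])
  · simp

/-- If all the relations of forms `f` are generated by linear ones, and an exponent from `K` times
a variable is never an exponent outside of `K` times a variable, then the relations of `f` are also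
relations of the parts supported on `K`. -/
theorem relations_le_relations_supportPart {n : ℕ} {f : Fin n → MvPolynomial σ k}
    {K : Finset (σ →₀ ℕ)}
    (hK : ∀ a, ∀ m ∈ (f a).support, ∀ m' ∈ K, ∀ x y : σ,
      Finsupp.single x 1 + m = Finsupp.single y 1 + m' → m ∈ K)
    (hlin : Submodule.span (MvPolynomial σ k)
      {c | c ∈ relations f ∧ ∀ a, (c a).IsHomogeneous 1} = relations f) :
    relations f ≤ relations fun a => supportPart K (f a) := by
  classical
  rw [← hlin, Submodule.span_le]
  rintro c ⟨hc, hc1⟩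
  simp only [relations, SetLike.mem_coe, LinearMap.mem_ker, Fintype.linearCombination_apply,
    smul_eq_mul] at hc ⊢
  have hX : ∀ a (i : σ →₀ ℕ), coeff i (c a) ≠ 0 → ∃ x, i = Finsupp.single x 1 := by
    intro a i hi
    have : i.degree = 1 := by
      by_contra h
      exact hi ((hc1 a).coeff_eq_zero h)
    exact (Finsupp.sum_eq_one_iff i).1 this
  ext N
  rw [coeff_sum, coeff_zero]
  -- If `N` is a variable times an exponent of `K`, every term contributing at `N` comes from `K`,
  -- so truncation changes nothing; otherwise no truncated term reaches `N`.
  by_cases hN : ∃ y, ∃ m' ∈ K, N = Finsupp.single y 1 + m'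
  · obtain ⟨y, m', hm', rfl⟩ := hN
    rw [← coeff_zero (Finsupp.single y 1 + m'), ← hc, coeff_sum]
    refine Finset.sum_congr rfl fun a _ => ?_
    rw [coeff_mul, coeff_mul]
    refine Finset.sum_congr rfl fun ij hij => ?_
    rw [Finset.HasAntidiagonal.mem_antidiagonal] at hij
    by_cases hi : coeff ij.1 (c a) = 0
    · simp [hi]
    · obtain ⟨x, hx⟩ := hX a _ hi
      rw [coeff_supportPart]
      split_ifs with hmem
      · rfl
      · have : coeff ij.2 (f a) = 0 := by
          by_contra h
          exact hmem (hK a _ (mem_support_iff.2 h) m' hm' x y (by rw [← hx, hij]))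
        rw [this]
  · refine Finset.sum_eq_zero fun a _ => ?_
    rw [coeff_mul]
    refine Finset.sum_eq_zero fun ij hij => ?_
    rw [Finset.HasAntidiagonal.mem_antidiagonal] at hij
    by_cases hi : coeff ij.1 (c a) = 0
    · simp [hi]
    · obtain ⟨x, hx⟩ := hX a _ hi
      rw [coeff_supportPart, if_neg, mul_zero]
      exact fun hmem => hN ⟨x, _, hmem, by rw [← hx, hij]⟩

/-- Forms of degree `d` with only linear relations do not generate monomials of degree `d` both
inside and outside of a set of exponents that is closed under linear adjacency. -/
theorem mem_iff_mem_of_linear_relations {n d : ℕ} {f : Fin n → MvPolynomial σ k}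
    (hf : ∀ a, (f a).IsHomogeneous d) {K : Finset (σ →₀ ℕ)}
    (hK : ∀ a, ∀ m ∈ (f a).support, ∀ m' ∈ K, ∀ x y : σ,
      Finsupp.single x 1 + m = Finsupp.single y 1 + m' → m ∈ K)
    (hlin : Submodule.span (MvPolynomial σ k)
      {c | c ∈ relations f ∧ ∀ a, (c a).IsHomogeneous 1} = relations f)
    {u v : σ →₀ ℕ} (hu : u.degree = d) (hv : v.degree = d)
    (hu' : monomial u 1 ∈ Ideal.span (Set.range f)) (hv' : monomial v 1 ∈ Ideal.span (Set.range f))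
    (huK : u ∈ K) : v ∈ K := by
  classical
  by_contra hvK
  obtain ⟨p, hp⟩ := Ideal.mem_span_range_iff_exists_fun.1 hu'
  obtain ⟨q, hq⟩ := Ideal.mem_span_range_iff_exists_fun.1 hv'
  have hg : ∀ a, (supportPart K (f a)).IsHomogeneous d := by
    intro a m hm
    rw [coeff_supportPart] at hm
    exact hf a (fun h => hm (by simp [h]))
  -- The trivial relation v · u − u · v = 0, written in the generators. After truncation to `K` its
  -- two halves have coefficients 1 and 0 at `u + v`.
  have hrel : (fun a => monomial v 1 * p a - monomial u 1 * q a) ∈ relations f := by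
    simp only [relations, LinearMap.mem_ker, Fintype.linearCombination_apply, smul_eq_mul,
      sub_mul, Finset.sum_sub_distrib, mul_assoc, ← Finset.mul_sum, hp, hq]
    ring
  have hrel' := relations_le_relations_supportPart hK hlin hrel
  simp only [relations, LinearMap.mem_ker, Fintype.linearCombination_apply, smul_eq_mul,
    sub_mul, Finset.sum_sub_distrib, mul_assoc, ← Finset.mul_sum, sub_eq_zero] at hrel'
  have hcoeff := congrArg (coeff (v + u)) hrel'
  rw [coeff_monomial_mul, add_comm v u, coeff_monomial_mul, one_mul, one_mul, coeff_sum,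
    coeff_sum] at hcoeff
  have h1 : ∑ a, coeff u (p a * supportPart K (f a)) = 1 := by
    have : coeff u (∑ a, p a * f a) = 1 := by rw [hp]; simp
    rw [← this, coeff_sum]
    refine Finset.sum_congr rfl fun a _ => ?_
    rw [coeff_mul_of_isHomogeneous (hg a) hu, coeff_mul_of_isHomogeneous (hf a) hu,
      coeff_supportPart, if_pos huK]
  have h2 : ∑ a, coeff v (q a * supportPart K (f a)) = 0 := by
    refine Finset.sum_eq_zero fun a _ => ?_
    rw [coeff_mul_of_isHomogeneous (hg a) hv, coeff_supportPart, if_neg hvK, mul_zero]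
  rw [h1, h2] at hcoeff
  exact one_ne_zero hcoeff

end LinearRelations

/-! ### Linear relations force a forest -/

section Cuts

variable {V : Type*} {G : SimpleGraph V} {k : Type*} [Field k] [Fintype G.edgeSet]

/-- If the monomials of two cuts become equal after multiplication by variables, then the cuts
agree on the edges that are not bridges. -/
theorem mem_cut_of_single_add_eq {A A' : Set V} {e₀ : G.edgeSet} (hb : ¬G.IsBridge e₀)
    {x y : G.edgeSet ⊕ G.edgeSet}
    (h : Finsupp.single x 1 + cutExponent G (cut G A Aᶜ) =
      Finsupp.single y 1 + cutExponent G (cut G A' A'ᶜ)) (he₀ : e₀ ∈ cut G A' A'ᶜ) :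
    e₀ ∈ cut G A Aᶜ := by
  classical
  by_contra hA
  refine hb (isBridge_of_cut_agree he₀ hA fun e hne => ?_)
  have h1 := DFunLike.congr_fun h (Sum.inl e₀)
  have h2 := DFunLike.congr_fun h (Sum.inr e₀)
  have h3 := DFunLike.congr_fun h (Sum.inl e)
  simp only [Finsupp.add_apply, cutExponent_inl, cutExponent_inr, Finsupp.single_apply, he₀, hA,
    if_true, if_false] at h1 h2 h3
  -- The exponents at e₀ can only be balanced by `x` = s_{e₀} and `y` = t_{e₀}, so no variable is
  -- left to alter any other edge.
  have hx : x = Sum.inl e₀ := by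
    by_contra hx
    rw [if_neg hx] at h1
    split_ifs at h1 <;> omega
  have hy : y = Sum.inr e₀ := by
    by_contra hy
    rw [if_neg hy] at h2
    split_ifs at h2 <;> omega
  subst hx hy
  have hne' : e₀ ≠ e := hne.symm
  simp only [Sum.inl.injEq, hne', if_false, reduceCtorEq, zero_add] at h3
  by_cases ha : e ∈ cut G A Aᶜ <;> by_cases ha' : e ∈ cut G A' A'ᶜ <;> simp_all

/-- All cut monomials have degree |E|, so one dividing a monomial of that degree equals it. -/
theorem support_subset_cutExponent_of_mem_cutIdeal {f : CutRing G k} (hf : f ∈ cutIdeal G k)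
    (hd : f.IsHomogeneous (Fintype.card G.edgeSet)) {m : G.edgeSet ⊕ G.edgeSet →₀ ℕ}
    (hm : m ∈ f.support) : ∃ A : Set V, m = cutExponent G (cut G A Aᶜ) := by
  obtain ⟨A, hA⟩ := mem_cutIdeal.1 hf m hm
  refine ⟨A, ?_⟩
  obtain ⟨r, rfl⟩ := le_iff_exists_add.1 hA
  have h1 : (cutExponent G (cut G A Aᶜ) + r).degree = Fintype.card G.edgeSet := by
    by_contra h
    exact mem_support_iff.1 hm (hd.coeff_eq_zero h)
  rw [map_add, degree_cutExponent, Nat.add_eq_left, Finsupp.degree_eq_zero_iff] at h1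
  rw [h1, add_zero]

/-- Some exponent of a generator divides the monomial of the empty cut, so d ≤ |E|; a cut monomial
divides it in turn, so d ≥ |E|. -/
theorem degree_eq_card_of_span_eq_cutIdeal {n d : ℕ} {f : Fin n → CutRing G k}
    (hf : ∀ a, (f a).IsHomogeneous d) (hspan : Ideal.span (Set.range f) = cutIdeal G k) :
    d = Fintype.card G.edgeSet := by
  classical
  set u := cutExponent G (cut G ∅ (∅ : Set V)ᶜ)
  have hu : monomial u 1 ∈ Ideal.span (Set.range f) := hspan ▸ monomial_cutExponent_mem k ∅
  obtain ⟨p, hp⟩ := Ideal.mem_span_range_iff_exists_fun.1 hu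
  have h1 : ∑ a, coeff u (p a * f a) = 1 := by rw [← coeff_sum, hp]; simp
  obtain ⟨a, -, ha⟩ := Finset.exists_ne_zero_of_sum_ne_zero (h1.trans_ne one_ne_zero)
  rw [coeff_mul] at ha
  obtain ⟨⟨i, j⟩, hij, hne⟩ := Finset.exists_ne_zero_of_sum_ne_zero ha
  rw [Finset.HasAntidiagonal.mem_antidiagonal] at hij
  have hj : coeff j (f a) ≠ 0 := right_ne_zero_of_mul hne
  have hjd : j.degree = d := by
    by_contra h
    exact hj ((hf a).coeff_eq_zero h)
  have hfa : f a ∈ cutIdeal G k := hspan ▸ Ideal.subset_span ⟨a, rfl⟩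
  obtain ⟨A, hA⟩ := mem_cutIdeal.1 hfa j (mem_support_iff.2 hj)
  have h2 := Finsupp.degree_mono hA
  have h3 := congrArg Finsupp.degree hij
  simp only [map_add] at h3
  rw [degree_cutExponent] at h2
  have h4 : u.degree = _ := degree_cutExponent _
  omega

theorem isAcyclic_of_hasOnlyLinearRelations (h : HasOnlyLinearRelations (cutIdeal G k)) :
    G.IsAcyclic := by
  classical
  obtain ⟨d, n, f, hf, hspan, -, hlin⟩ := h
  obtain rfl := degree_eq_card_of_span_eq_cutIdeal hf hspan
  rw [SimpleGraph.isAcyclic_iff_forall_isBridge]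
  intro e he
  by_contra hb
  have hfin : (Set.range (cutExponent G)).Finite := Set.finite_range _
  -- The cuts through the non-bridge `e`: closed under linear adjacency, but missing the empty cut.
  let K : Finset (G.edgeSet ⊕ G.edgeSet →₀ ℕ) :=
    hfin.toFinset.filter fun m => m (Sum.inl ⟨e, he⟩) ≠ 0 ∧
      ∃ A : Set V, m = cutExponent G (cut G A Aᶜ)
  have hmemK : ∀ A : Set V, cutExponent G (cut G A Aᶜ) ∈ K ↔ ⟨e, he⟩ ∈ cut G A Aᶜ := by
    intro A
    simp only [K, Finset.mem_filter, Set.Finite.mem_toFinset, Set.mem_range_self, true_and,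
      cutExponent_inl]
    exact ⟨fun h => by simpa using h.1, fun h => ⟨by simp [h], A, rfl⟩⟩
  have hK : ∀ a, ∀ m ∈ (f a).support, ∀ m' ∈ K, ∀ x y,
      Finsupp.single x 1 + m = Finsupp.single y 1 + m' → m ∈ K := by
    intro a m hm m' hm' x y hxy
    obtain ⟨A, rfl⟩ := support_subset_cutExponent_of_mem_cutIdeal
      (hspan ▸ Ideal.subset_span ⟨a, rfl⟩) (hf a) hm
    obtain ⟨A', rfl⟩ := (Finset.mem_filter.1 hm').2.2
    rw [hmemK] at hm' ⊢
    exact mem_cut_of_single_add_eq hb hxy hm'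
  obtain ⟨A, hA⟩ : ∃ A : Set V, ⟨e, he⟩ ∈ cut G A Aᶜ := by
    clear * -
    induction e with
    | h v w =>
      have hvw : v ≠ w := G.ne_of_adj he
      exact ⟨{v}, (mem_cut_compl rfl).2 (by simp [hvw.symm])⟩
  have := mem_iff_mem_of_linear_relations hf hK hlin
    (degree_cutExponent (cut G A Aᶜ)) (degree_cutExponent (cut G ∅ (∅ : Set V)ᶜ))
    (hspan ▸ monomial_cutExponent_mem k A) (hspan ▸ monomial_cutExponent_mem k ∅) ((hmemK A).2 hA)
  rw [hmemK] at this
  exact notMem_cut_empty _ _ this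

end Cuts

open Matrix

/-! ### Linear resolutions by mapping cones -/

section LinearResolutions

variable {σ k : Type*} [Field k]

/-- A linear resolution of an ideal generated in degree `d`, with arbitrary finite index types. -/
structure IndexedLinearResolution (I : Ideal (MvPolynomial σ k)) (d : ℕ) where
  ι : ℕ → Type
  fintype : ∀ i, Fintype (ι i)
  gen : ι 0 → MvPolynomial σ k
  diff : ∀ i, Matrix (ι i) (ι (i + 1)) (MvPolynomial σ k)
  gen_homogeneous : ∀ a, (gen a).IsHomogeneous d
  diff_homogeneous : ∀ i a b, (diff i a b).IsHomogeneous 1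
  span_gen : Ideal.span (Set.range gen) = I
  exact_zero : ∀ x, x ⬝ᵥ gen = 0 ↔ ∃ y, diff 0 *ᵥ y = x
  exact_succ : ∀ i x, diff i *ᵥ x = 0 ↔ ∃ y, diff (i + 1) *ᵥ y = x

attribute [instance] IndexedLinearResolution.fintype

/-- Enumerate the index types; minimality is automatic, as linear forms have no constant term. -/
theorem IndexedLinearResolution.hasLinearResolution {I : Ideal (MvPolynomial σ k)} {d : ℕ}
    (F : IndexedLinearResolution I d) : HasLinearResolution I := by
  let e : ∀ i, F.ι i ≃ Fin (Fintype.card (F.ι i)) := fun i => Fintype.equivFin _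
  have hsub : ∀ i x, (F.diff i).submatrix (e i).symm (e (i + 1)).symm *ᵥ x =
      (F.diff i *ᵥ (x ∘ e (i + 1))) ∘ (e i).symm := fun i x => by
    rw [submatrix_mulVec_equiv, Equiv.symm_symm]
  have hrange : ∀ i x, (∃ y, (F.diff i).submatrix (e i).symm (e (i + 1)).symm *ᵥ y = x) ↔
      ∃ y, F.diff i *ᵥ y = x ∘ e i := by
    intro i x
    constructor
    · rintro ⟨y, rfl⟩
      refine ⟨y ∘ e (i + 1), ?_⟩
      rw [hsub]
      ext
      simp
    · rintro ⟨y, hy⟩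
      refine ⟨y ∘ (e (i + 1)).symm, ?_⟩
      rw [hsub, Function.comp_assoc, Equiv.symm_comp_self, Function.comp_id, hy]
      ext
      simp
  refine ⟨{
    rank := fun i => Fintype.card (F.ι i)
    deg := fun i _ => d + i
    gen := F.gen ∘ (e 0).symm
    diff := fun i => (F.diff i).submatrix (e i).symm (e (i + 1)).symm
    gen_homogeneous := fun a => F.gen_homogeneous _
    diff_homogeneous := fun i a b => Or.inr ⟨1, rfl, F.diff_homogeneous i _ _⟩
    span_gen := ?_
    exact_zero := ?_
    exact_succ := ?_ }, ?_, d, fun i a => rfl⟩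
  · rw [Set.range_comp, (e 0).symm.range_eq_univ, Set.image_univ, F.span_gen]
  · ext x
    rw [LinearMap.mem_ker, LinearMap.mem_range, Fintype.linearCombination_apply]
    simp only [mulVecLin_apply]
    rw [hrange, ← F.exact_zero, dotProduct, ← (e 0).symm.sum_comp]
    simp
  · intro i
    ext x
    rw [LinearMap.mem_ker, LinearMap.mem_range]
    simp only [mulVecLin_apply]
    rw [hrange, ← F.exact_succ, hsub]
    constructor
    · intro h
      funext a
      have := congrFun h (e i a)
      simpa using this
    · intro h
      rw [h]
      rfl
  · intro i a b
    exact (F.diff_homogeneous i _ _).coeff_eq_zero (by simp)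

/-- The unit ideal has a linear resolution. -/
theorem IndexedLinearResolution.nonempty_top :
    Nonempty (IndexedLinearResolution (⊤ : Ideal (MvPolynomial σ k)) 0) := by
  have hempty : ∀ i, IsEmpty {_x : Unit // i + 1 = 0} := fun i => ⟨fun x => by simpa using x.2⟩
  refine ⟨{
    ι := fun i => {_x : Unit // i = 0}
    fintype := fun i => inferInstance
    gen := fun _ => 1
    diff := fun _ => 0
    gen_homogeneous := fun _ => isHomogeneous_one _ _
    diff_homogeneous := fun _ _ _ => isHomogeneous_zero _ _ _
    span_gen := ?_
    exact_zero := fun x => ?_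
    exact_succ := fun i x => ?_ }⟩
  · exact (Ideal.eq_top_iff_one _).2 (Ideal.subset_span ⟨⟨(), rfl⟩, rfl⟩)
  · simp only [zero_mulVec, exists_const]
    constructor
    · intro h
      ext1 ⟨⟨⟩, _⟩
      rw [dotProduct, Fintype.sum_subsingleton _ ⟨(), rfl⟩, mul_one] at h
      exact h.symm
    · rintro rfl
      simp
  · simp only [zero_mulVec, exists_const, true_iff]
    have := hempty i
    exact Subsingleton.elim _ _

/-- The index types of the mapping cone of a map `F → F ⊕ F`. -/
def coneIndex (ι : ℕ → Type) : ℕ → Type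
  | 0 => ι 0 ⊕ ι 0
  | i + 1 => (ι (i + 1) ⊕ ι (i + 1)) ⊕ ι i

instance (ι : ℕ → Type) [∀ i, Fintype (ι i)] : ∀ i, Fintype (coneIndex ι i)
  | 0 => inferInstanceAs (Fintype (ι 0 ⊕ ι 0))
  | i + 1 => inferInstanceAs (Fintype ((ι (i + 1) ⊕ ι (i + 1)) ⊕ ι i))

open Classical in
/-- The matrix of `(x, y, z) ↦ (D x + t z, D y - s z)`. -/
noncomputable def koszulBlock {R m n : Type*} [CommRing R] (s t : R) (D : Matrix m n R) :
    Matrix (m ⊕ m) ((n ⊕ n) ⊕ m) R :=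
  fromCols (fromBlocks D 0 0 D) (fromRows (t • (1 : Matrix m m R)) (-(s • (1 : Matrix m m R))))

theorem koszulBlock_mulVec {R m n : Type*} [CommRing R] [Fintype m] [Fintype n] (s t : R)
    (D : Matrix m n R) (x y : n → R) (z : m → R) :
    koszulBlock s t D *ᵥ Sum.elim (Sum.elim x y) z =
      Sum.elim (D *ᵥ x + t • z) (D *ᵥ y - s • z) := by
  classical
  rw [koszulBlock, fromCols_mulVec_sumElim, fromBlocks_mulVec, fromRows_mulVec]
  ext (i | i) <;> simp [neg_mulVec, smul_mulVec, sub_eq_add_neg]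

/-- The differentials of the mapping cone of `(t, -s) : F → F ⊕ F`. -/
noncomputable def coneDiff {R : Type*} [CommRing R] {ι : ℕ → Type} (s t : R)
    (D : ∀ i, Matrix (ι i) (ι (i + 1)) R) :
    ∀ i, Matrix (coneIndex ι i) (coneIndex ι (i + 1)) R
  | 0 => koszulBlock s t (D 0)
  -- The sign of `-D i` cancels the terms t D z and −s D z in consecutive differentials.
  | i + 1 => fromRows (koszulBlock s t (D (i + 1))) (fromCols 0 (-D i))

theorem isHomogeneous_koszulBlock {m n : Type*} {s t : MvPolynomial σ k} (hs : s.IsHomogeneous 1)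
    (ht : t.IsHomogeneous 1) {D : Matrix m n (MvPolynomial σ k)}
    (hD : ∀ a b, (D a b).IsHomogeneous 1) (a : m ⊕ m) (b : (n ⊕ n) ⊕ m) :
    (koszulBlock s t D a b).IsHomogeneous 1 := by
  classical
  rcases a with a | a <;> rcases b with (b | b) | b <;>
    simp [koszulBlock, hD, isHomogeneous_zero, one_apply]
  · split_ifs <;> simp [ht, isHomogeneous_zero]
  · split_ifs <;> simp [hs.neg, isHomogeneous_zero]

theorem exists_eq_sumElim {α β γ : Type*} (x : α ⊕ β → γ) : ∃ y z, x = Sum.elim y z :=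
  ⟨x ∘ Sum.inl, x ∘ Sum.inr, by simp⟩

/-- The mapping cone of `(t, -s) : F → F ⊕ F` resolves `(s, t) I` if `s, t` is a regular sequence
relative to `I`. -/
theorem IndexedLinearResolution.nonempty_span_pair_mul {I : Ideal (MvPolynomial σ k)} {d : ℕ}
    (F : IndexedLinearResolution I d) {s t : MvPolynomial σ k} (hs : s.IsHomogeneous 1)
    (ht : t.IsHomogeneous 1) (ht₀ : t ≠ 0)
    (hst : ∀ a ∈ I, ∀ b ∈ I, s * a + t * b = 0 → ∃ c ∈ I, a = t * c ∧ b = -(s * c)) :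
    Nonempty (IndexedLinearResolution (Ideal.span {s, t} * I) (d + 1)) := by
  have hmem : ∀ x, x ⬝ᵥ F.gen ∈ I := fun x =>
    F.span_gen.le (Ideal.mem_span_range_iff_exists_fun.2 ⟨x, rfl⟩)
  have hgen : ∀ y, (F.diff 0 *ᵥ y) ⬝ᵥ F.gen = 0 := fun y => (F.exact_zero _).2 ⟨y, rfl⟩
  have hdd : ∀ i y, F.diff i *ᵥ (F.diff (i + 1) *ᵥ y) = 0 :=
    fun i y => (F.exact_succ i _).2 ⟨y, rfl⟩
  have hcone : ∀ i (x y : F.ι (i + 1 + 1) → MvPolynomial σ k) (z : F.ι (i + 1) → _),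
      coneDiff s t F.diff (i + 1) *ᵥ Sum.elim (Sum.elim x y) z =
        Sum.elim (Sum.elim (F.diff (i + 1) *ᵥ x + t • z) (F.diff (i + 1) *ᵥ y - s • z))
          (-(F.diff i *ᵥ z)) := by
    intro i x y z
    have h := fromRows_mulVec (koszulBlock s t (F.diff (i + 1))) (fromCols 0 (-F.diff i))
      (Sum.elim (Sum.elim x y) z)
    rw [koszulBlock_mulVec, fromCols_mulVec_sumElim, zero_mulVec, zero_add, neg_mulVec] at h
    exact h
  refine ⟨{
    ι := coneIndex F.ι
    fintype := inferInstance
    gen := Sum.elim (s • F.gen) (t • F.gen)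
    diff := coneDiff s t F.diff
    gen_homogeneous := ?_
    diff_homogeneous := ?_
    span_gen := ?_
    exact_zero := ?_
    exact_succ := ?_ }⟩
  · rintro (a | a)
    · exact add_comm 1 d ▸ hs.mul (F.gen_homogeneous a)
    · exact add_comm 1 d ▸ ht.mul (F.gen_homogeneous a)
  · rintro (_ | i) a b
    · exact isHomogeneous_koszulBlock hs ht (F.diff_homogeneous 0) a b
    · rcases a with a | a
      · exact isHomogeneous_koszulBlock hs ht (F.diff_homogeneous (i + 1)) a b
      · rcases b with b | b
        · exact isHomogeneous_zero _ _ _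
        · exact (F.diff_homogeneous i a b).neg
  · refine Eq.trans ?_ (congrArg (Ideal.span {s, t} * ·) F.span_gen)
    rw [Ideal.span_mul_span']
    congr 1
    ext f
    simp only [Set.mem_range, Set.mem_mul, Set.mem_insert_iff, Set.mem_singleton_iff]
    constructor
    · rintro ⟨a | a, rfl⟩
      · exact ⟨s, Or.inl rfl, _, ⟨a, rfl⟩, rfl⟩
      · exact ⟨t, Or.inr rfl, _, ⟨a, rfl⟩, rfl⟩
    · rintro ⟨_, rfl | rfl, _, ⟨a, rfl⟩, rfl⟩
      · exact ⟨Sum.inl a, rfl⟩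
      · exact ⟨Sum.inr a, rfl⟩
  · intro v
    obtain ⟨x, y, rfl⟩ := exists_eq_sumElim v
    have hdot : (Sum.elim x y : coneIndex F.ι 0 → _) ⬝ᵥ Sum.elim (s • F.gen) (t • F.gen) =
        s * (x ⬝ᵥ F.gen) + t * (y ⬝ᵥ F.gen) := by
      refine (sumElim_dotProduct_sumElim ..).trans ?_
      rw [dotProduct_smul, dotProduct_smul, smul_eq_mul, smul_eq_mul]
    refine (Eq.congr_left hdot).trans ?_
    constructor
    · intro h
      obtain ⟨c, hc, h1, h2⟩ := hst _ (hmem x) _ (hmem y) h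
      obtain ⟨w, hw⟩ := Ideal.mem_span_range_iff_exists_fun.1 (F.span_gen.ge hc)
      replace hw : w ⬝ᵥ F.gen = c := hw
      obtain ⟨y₁, hy₁⟩ := (F.exact_zero (x - t • w)).1 (by
        rw [sub_dotProduct, smul_dotProduct, hw, h1, smul_eq_mul, sub_self])
      obtain ⟨y₂, hy₂⟩ := (F.exact_zero (y + s • w)).1 (by
        rw [add_dotProduct, smul_dotProduct, hw, h2, smul_eq_mul, neg_add_cancel])
      refine ⟨Sum.elim (Sum.elim y₁ y₂) w, (koszulBlock_mulVec ..).trans ?_⟩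
      rw [hy₁, hy₂, sub_add_cancel, add_sub_cancel_right]
    · rintro ⟨v, hv⟩
      obtain ⟨v, z, rfl⟩ := exists_eq_sumElim v
      obtain ⟨x', y', rfl⟩ := exists_eq_sumElim v
      obtain ⟨rfl, rfl⟩ := Sum.elim_eq_iff.1 ((koszulBlock_mulVec ..).symm.trans hv)
      rw [add_dotProduct, sub_dotProduct, hgen, hgen, smul_dotProduct, smul_dotProduct,
        smul_eq_mul, smul_eq_mul]
      ring
  · intro i v
    constructor
    · intro hv
      obtain ⟨v, z, rfl⟩ := exists_eq_sumElim v
      obtain ⟨x, y, rfl⟩ := exists_eq_sumElim v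
      -- The `z` component is a boundary. At the bottom, pairing the first equation with the
      -- generators gives t (z · gen) = 0 with t ≠ 0; higher up, the cone equation itself contains D
      -- z = 0.
      obtain ⟨w, hw, h1, h2⟩ : ∃ w, F.diff i *ᵥ w = -z ∧
          F.diff i *ᵥ x + t • z = 0 ∧ F.diff i *ᵥ y - s • z = 0 := by
        cases i with
        | zero =>
          have h := (koszulBlock_mulVec ..).symm.trans (hv.trans Sum.elim_zero_zero.symm)
          obtain ⟨h1, h2⟩ := Sum.elim_eq_iff.1 h
          obtain ⟨w, hw⟩ := (F.exact_zero (-z)).1 (by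
            have h3 := congrArg (· ⬝ᵥ F.gen) h1
            simp only [add_dotProduct, hgen, zero_add, smul_dotProduct, zero_dotProduct,
              smul_eq_mul, mul_eq_zero, ht₀, false_or] at h3
            rw [neg_dotProduct, h3, neg_zero])
          exact ⟨w, hw, h1, h2⟩
        | succ i =>
          have h := (hcone i x y z).symm.trans (hv.trans Sum.elim_zero_zero.symm)
          obtain ⟨h1, h3⟩ := Sum.elim_eq_iff.1 h
          obtain ⟨h1, h2⟩ := Sum.elim_eq_iff.1 (h1.trans Sum.elim_zero_zero.symm)
          obtain ⟨w, hw⟩ := (F.exact_succ i (-z)).1 (by rw [mulVec_neg, h3])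
          exact ⟨w, hw, h1, h2⟩
      obtain ⟨y₁, hy₁⟩ := (F.exact_succ i (x - t • w)).1 (by
        rw [mulVec_sub, mulVec_smul, hw, smul_neg, sub_neg_eq_add, h1])
      obtain ⟨y₂, hy₂⟩ := (F.exact_succ i (y + s • w)).1 (by
        rw [mulVec_add, mulVec_smul, hw, smul_neg, ← sub_eq_add_neg, h2])
      refine ⟨Sum.elim (Sum.elim y₁ y₂) w, (hcone ..).trans ?_⟩
      rw [hy₁, hy₂, hw, sub_add_cancel, add_sub_cancel_right, neg_neg]
    · rintro ⟨v, rfl⟩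
      obtain ⟨v, z, rfl⟩ := exists_eq_sumElim v
      obtain ⟨x, y, rfl⟩ := exists_eq_sumElim v
      rw [hcone]
      cases i with
      | zero =>
        refine (koszulBlock_mulVec ..).trans ?_
        rw [mulVec_add, mulVec_sub, hdd, hdd, mulVec_smul, mulVec_smul]
        simp
        rfl
      | succ i =>
        refine (hcone ..).trans ?_
        rw [mulVec_add, mulVec_sub, mulVec_neg, hdd, hdd, hdd, mulVec_smul, mulVec_smul]
        simp
        rfl

theorem hasOnlyLinearRelations_of_hasLinearResolution {I : Ideal (MvPolynomial σ k)}
    (h : HasLinearResolution I) : HasOnlyLinearRelations I := by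
  classical
  obtain ⟨F, hmin, d, hd⟩ := h
  have hrel : ∀ c ∈ relations F.gen, ∃ y, F.diff 0 *ᵥ y = c := fun c hc => by
    rw [relations, F.exact_zero] at hc
    exact hc
  refine ⟨d, F.rank 0, F.gen, fun a => by simpa [hd] using F.gen_homogeneous a,
    F.span_gen, fun a ha => ?_, ?_⟩
  · obtain ⟨c, hc⟩ := (Fintype.mem_span_image_iff_exists_fun _).1 ha
    -- A redundant generator gives a relation with coefficient −1 at `a`, but images of `F.diff 0`
    -- have zero constant terms by minimality.
    have hcrel : (fun b => (if h : b ≠ a then c ⟨b, h⟩ else -1)) ∈ relations F.gen := by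
      rw [relations, LinearMap.mem_ker, Fintype.linearCombination_apply,
        ← Finset.add_sum_erase _ _ (Finset.mem_univ a)]
      simp only [ne_eq, not_true_eq_false, dite_false, smul_eq_mul, neg_mul, one_mul]
      rw [neg_add_eq_zero, ← hc, Finset.sum_subtype (p := fun b => b ≠ a) _ (by simp)]
      refine Finset.sum_congr rfl fun b _ => ?_
      rw [smul_eq_mul, dif_pos (show ¬(b : Fin _) = a from b.2)]
    obtain ⟨y, hy⟩ := hrel _ hcrel
    have h1 := congrArg constantCoeff (congrFun hy a)
    simp [mulVec, dotProduct, hmin 0 a] at h1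
  · refine le_antisymm (Submodule.span_le.2 fun c hc => hc.1) fun c hc => ?_
    obtain ⟨y, rfl⟩ := hrel c hc
    have hy : F.diff 0 *ᵥ y = ∑ b, y b • (F.diff 0).col b := by
      ext1 a
      simp [mulVec, dotProduct, mul_comm]
    rw [hy]
    -- The columns of the first differential are linear relations, since the degrees go up by one.
    refine Submodule.sum_mem _ fun b _ => Submodule.smul_mem _ _ (Submodule.subset_span ⟨?_, ?_⟩)
    · rw [relations, F.exact_zero]
      exact ⟨Pi.single b 1, by simp⟩
    · intro a
      rcases F.diff_homogeneous 0 a b with h | ⟨e, he, h⟩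
      · rw [col_apply, h]
        exact isHomogeneous_zero _ _ _
      · rw [hd, hd] at he
        obtain rfl : e = 1 := by omega
        exact h

end LinearResolutions

/-! ### Resolving the cut ideal of a forest -/

section Trees

variable {V : Type*} {G : SimpleGraph V} (k : Type*) [Field k]

/-- A monomial in the intersection is divisible by s_e or t_e, and removing that variable does not
affect membership in the primes of other edges. -/
theorem edgeIdeal_mul_finsetInf [DecidableEq G.edgeSet] {T : Finset G.edgeSet} {e : G.edgeSet}
    (he : e ∉ T) :
    edgeIdeal k e * T.inf (edgeIdeal k) = (insert e T).inf (edgeIdeal k) := by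
  rw [Finset.inf_insert]
  refine le_antisymm Ideal.mul_le_inf fun f hf => ?_
  rw [Submodule.mem_inf, Submodule.mem_finsetInf] at hf
  rw [f.as_sum]
  refine Ideal.sum_mem _ fun m hm => ?_
  have key : ∀ i : G.edgeSet ⊕ G.edgeSet, i = Sum.inl e ∨ i = Sum.inr e → m i ≠ 0 →
      monomial m (coeff m f) ∈ edgeIdeal k e * T.inf (edgeIdeal k) := by
    intro i hi hmi
    have hle : Finsupp.single i 1 ≤ m := by
      rw [Finsupp.single_le_iff]
      omega
    obtain ⟨r, rfl⟩ := le_iff_exists_add.1 hle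
    have : (monomial (Finsupp.single i 1 + r) (coeff (Finsupp.single i 1 + r) f) : CutRing G k) =
        X i * monomial r (coeff (Finsupp.single i 1 + r) f) := by
      rw [X, monomial_mul, one_mul]
    rw [this]
    refine Ideal.mul_mem_mul (X_mem_span_X_image.2 hi) ?_
    rw [Submodule.mem_finsetInf]
    intro e' he'
    have hne : e ≠ e' := by rintro rfl; exact he he'
    refine mem_edgeIdeal.2 fun m' hm' => ?_
    obtain rfl := Finset.mem_singleton.1 (support_monomial_subset hm')
    have := mem_edgeIdeal.1 (hf.2 e' he') _ hm
    rcases hi with rfl | rfl <;> simpa [Finsupp.single_apply, hne] using this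
  rcases mem_edgeIdeal.1 hf.1 m hm with h | h
  · exact key _ (Or.inl rfl) h
  · exact key _ (Or.inr rfl) h

/-- Modulo an intersection of ideals of other edges, `s_e, t_e` only has the Koszul relation. -/
theorem exists_koszul_relation {T : Finset G.edgeSet} {e : G.edgeSet} (he : e ∉ T)
    {a b : CutRing G k} (ha : a ∈ T.inf (edgeIdeal k))
    (h : sVar k e * a + tVar k e * b = 0) :
    ∃ c ∈ T.inf (edgeIdeal k), a = tVar k e * c ∧ b = -(sVar k e * c) := by
  have ht : Prime (tVar k e) := X_prime
  -- The prime t_e does not divide s_e, hence divides `a`. The quotient `c` stays in each (s_{e'},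
  -- t_{e'}), a prime not containing t_e.
  have hdvd : tVar k e ∣ sVar k e * a := ⟨-b, by linear_combination h⟩
  obtain ⟨c, rfl⟩ := (ht.dvd_or_dvd hdvd).resolve_left (by simp [tVar, sVar, X_dvd_X])
  refine ⟨c, ?_, rfl, mul_left_cancel₀ ht.ne_zero (by linear_combination h)⟩
  rw [Submodule.mem_finsetInf] at ha ⊢
  intro e' he'
  refine ((inferInstance : (edgeIdeal k e').IsPrime).mem_or_mem (ha e' he')).resolve_left ?_
  rw [edgeIdeal, tVar, X_mem_span_X_image]
  rintro (h | h)
  · cases h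
  · exact he (Sum.inr.inj h ▸ he')

/-- Each new edge multiplies the ideal by (s_e, t_e), and one mapping cone raises the degree by one.
-/
theorem nonempty_indexedLinearResolution_finsetInf (T : Finset G.edgeSet) :
    Nonempty (IndexedLinearResolution (T.inf (edgeIdeal k)) T.card) := by
  classical
  induction T using Finset.induction_on with
  | empty => exact IndexedLinearResolution.nonempty_top
  | insert e T he ih =>
    obtain ⟨F⟩ := ih
    rw [Finset.card_insert_of_notMem he, ← edgeIdeal_mul_finsetInf k he, edgeIdeal_eq_span_pair]
    exact F.nonempty_span_pair_mul (isHomogeneous_X _ _) (isHomogeneous_X _ _) (X_ne_zero _)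
      fun a ha b _ h => exists_koszul_relation k he ha h

theorem hasLinearResolution_cutIdeal_of_isAcyclic [Fintype G.edgeSet] (hG : G.IsAcyclic) :
    HasLinearResolution (cutIdeal G k) := by
  obtain ⟨F⟩ := nonempty_indexedLinearResolution_finsetInf k (Finset.univ : Finset G.edgeSet)
  rw [cutIdeal_eq_inf_edgeIdeal k hG]
  exact F.hasLinearResolution

end Trees

end MonomialCut

theorem mainTheorem2 {V : Type*} [Fintype V] [DecidableEq V] (G : SimpleGraph V)
    [DecidableRel G.Adj] (hG : G.Connected) (k : Type*) [Field k] :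
    List.TFAE [
      MonomialCut.IsUnmixed (MonomialCut.cutIdeal G k),
      MonomialCut.HasLinearResolution (MonomialCut.cutIdeal G k),
      MonomialCut.HasOnlyLinearRelations (MonomialCut.cutIdeal G k),
      G.IsTree] := by
  tfae_have 4 → 1 := fun h => MonomialCut.isUnmixed_cutIdeal_of_isAcyclic k h.isAcyclic
  tfae_have 1 → 4 := fun h => ⟨hG, MonomialCut.isAcyclic_of_isUnmixed k h⟩
  tfae_have 4 → 2 := fun h => MonomialCut.hasLinearResolution_cutIdeal_of_isAcyclic k h.isAcyclic
  tfae_have 2 → 3 := MonomialCut.hasOnlyLinearRelations_of_hasLinearResolution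
  tfae_have 3 → 4 := fun h => ⟨hG, MonomialCut.isAcyclic_of_hasOnlyLinearRelations h⟩
  tfae_finish
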